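/- \textbf{Lemma.} Let $D$ be a disk diagram (a finite combinatorial cell structure on the $2$-sphere with one open $2$-cell removed, i.e. a compact contractible $2$-complex with an embedding in the plane) in which the attaching map of every $2$-cell is an immersed closed path. Let $\Phi: W\to D^1$ be the map from the disjoint union $W=\bigsqcup_i w_i$ of the boundary circles of the $2$-cells $r_i$ to the $1$-skeleton that is induced by the attaching maps. A \emph{stacking} of $D$ is a continuous injection $\Psi: W\to D^1\times\mathbb{R}$ whose first coordinate is $\Phi$; write $\eta: W\to\mathbb{R}$ for its second coordinate. The stacking is \emph{good} if for each $i$ there are points $h_i,\ell_i\in w_i$ such that $\eta(h_i)$ is the largest value of $\eta$ on $\Phi^{-1}(\Phi(h_i))$ and $\eta(\ell_i)$ is the smallest value of $\eta$ on $\Phi^{-1}(\Phi(\ell_i))$. The \emph{directed dual graph} $\Gamma$ has a vertex for each $2$-cell, and for each pair of sides of $2$-cells $r_1,r_2$ (possibly $r_1=r_2$) along a common $1$-cell $e$, an edge directed from $r_1$ to $r_2$ if over the interior of $e$ the side of $r_1$ is lower (has smaller $\eta$) than the side of $r_2$. If $D$ has a good stacking, then the directed dual graph $\Gamma$ determined by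 it is acyclic: it has no directed cycle (in particular, no directed loop). -/

import Mathlib

open scoped unitInterval

universe u v w

/-- A combinatorial 2-complex. The 1-skeleton is a graph, possibly with loops and multiple edges,
given by its oriented 1-cells ("darts"); `inv` reverses a dart, and a 1-cell is a pair
`{d, inv d}`. Each 2-cell `f` is attached along a closed edge path of length `len f > 0`, whose
darts are `bd f i`, with `i` taken modulo `len f`. -/
structure TwoComplex where
  Vertex : Type u
  Dart : Type v
  Cell : Type w
  source : Dart → Vertex
  inv : Dart → Dart
  inv_inv : ∀ d, inv (inv d) = d
  inv_ne : ∀ d, inv d ≠ d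
  len : Cell → ℕ
  len_pos : ∀ f, 0 < len f
  bd : (f : Cell) → ZMod (len f) → Dart
  bd_closed : ∀ f i, source (inv (bd f i)) = source (bd f (i + 1))

namespace TwoComplex

variable (X : TwoComplex.{u, v, w})

/-- The terminal vertex of a dart. -/
def target (d : X.Dart) : X.Vertex := X.source (X.inv d)

/-- The attaching maps are immersions: no boundary path of a 2-cell backtracks, cyclically. -/
def HasImmersedBoundaries : Prop :=
  ∀ f i, X.bd f (i + 1) ≠ X.inv (X.bd f i)

/-- The sides of 2-cells along 1-cells: the side `⟨f, i⟩` is the `i`-th edge of the boundary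
path of `f`. -/
def Side : Type w := Σ f : X.Cell, ZMod (X.len f)

/-- The dart traversed by a side. -/
def sideDart (s : X.Side) : X.Dart := X.bd s.1 s.2

/-! ### The 1-skeleton as a topological space -/

/-- The gluing that produces the 1-skeleton from its vertices and one copy of `[0,1]` per dart:
the copies of `d` and `inv d` are identified by `t ↦ 1 - t`, and the start of `d` is glued to the
vertex `source d`. -/
inductive SkeletonRel :
    ((Σ _ : X.Vertex, PUnit.{1}) ⊕ (Σ _ : X.Dart, I)) →
      ((Σ _ : X.Vertex, PUnit.{1}) ⊕ (Σ _ : X.Dart, I)) → Prop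
  | flip (d : X.Dart) (t : I) :
      SkeletonRel (Sum.inr ⟨d, t⟩) (Sum.inr ⟨X.inv d, unitInterval.symm t⟩)
  | start (d : X.Dart) :
      SkeletonRel (Sum.inr ⟨d, 0⟩) (Sum.inl ⟨X.source d, PUnit.unit⟩)

/-- The topological 1-skeleton `X¹`. -/
def OneSkeleton : Type (max u v) := Quot X.SkeletonRel

instance : TopologicalSpace X.OneSkeleton :=
  inferInstanceAs (TopologicalSpace (Quot X.SkeletonRel))

/-- The point of `X¹` at parameter `t` along the dart `d`. -/
def dartPoint (d : X.Dart) (t : I) : X.OneSkeleton :=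
  Quot.mk X.SkeletonRel (Sum.inr ⟨d, t⟩)

/-- The point of `X¹` given by a vertex. -/
def vertexPoint (x : X.Vertex) : X.OneSkeleton :=
  Quot.mk X.SkeletonRel (Sum.inl ⟨x, PUnit.unit⟩)

theorem dartPoint_zero (d : X.Dart) : X.dartPoint d 0 = X.vertexPoint (X.source d) :=
  Quot.sound (SkeletonRel.start d)

theorem dartPoint_symm (d : X.Dart) (t : I) :
    X.dartPoint (X.inv d) (unitInterval.symm t) = X.dartPoint d t :=
  (Quot.sound (SkeletonRel.flip d t)).symm

theorem dartPoint_one (d : X.Dart) : X.dartPoint d 1 = X.vertexPoint (X.target d) := by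
  rw [← X.dartPoint_symm d 1, unitInterval.symm_one, X.dartPoint_zero, target]

/-! ### The boundary circles of the 2-cells -/

/-- The gluing that produces the boundary circles: the end of the `i`-th side of `f` is glued to
the start of the next side of `f`. -/
inductive CircleRel : (Σ _ : X.Side, I) → (Σ _ : X.Side, I) → Prop
  | corner (f : X.Cell) (i : ZMod (X.len f)) : CircleRel ⟨⟨f, i⟩, 1⟩ ⟨⟨f, i + 1⟩, 0⟩

/-- The space `W`, the disjoint union of the boundary circles of all 2-cells; the circle of `f`
is subdivided into `len f` edges. -/
def BoundaryCircles : Type w := Quot X.CircleRel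

instance : TopologicalSpace X.BoundaryCircles :=
  inferInstanceAs (TopologicalSpace (Quot X.CircleRel))

/-- The point of `W` at parameter `t` along the side `s`. -/
def sidePoint (s : X.Side) (t : I) : X.BoundaryCircles := Quot.mk X.CircleRel ⟨s, t⟩

/-- The 2-cell on whose boundary circle a point of `W` lies. -/
def cellOf : X.BoundaryCircles → X.Cell :=
  Quot.lift (fun p => p.1.1) (by rintro _ _ ⟨f, i⟩; rfl)

/-- The map `Φ : W → X¹` induced by the attaching maps. -/
def attach : X.BoundaryCircles → X.OneSkeleton :=
  Quot.lift (fun p => X.dartPoint (X.sideDart p.1) p.2) (by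
    rintro _ _ ⟨f, i⟩
    change X.dartPoint (X.bd f i) 1 = X.dartPoint (X.bd f (i + 1)) 0
    rw [X.dartPoint_one, X.dartPoint_zero, target, X.bd_closed])

/-! ### Stackings and the directed dual graph -/

/-- A stacking: a continuous injection `Ψ : W → X¹ × ℝ` lifting `Φ`. -/
structure Stacking where
  toFun : X.BoundaryCircles → X.OneSkeleton × ℝ
  continuous_toFun : Continuous toFun
  injective_toFun : Function.Injective toFun
  fst_toFun : ∀ x, (toFun x).1 = X.attach x

namespace Stacking

variable {X} (Ψ : X.Stacking)

/-- The height of a point of `W`. -/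
def height (x : X.BoundaryCircles) : ℝ := (Ψ.toFun x).2

/-- A stacking is good if the boundary circle of every 2-cell has a point which is highest, and a
point which is lowest, among the points of `W` over the same point of `X¹`. -/
def IsGood : Prop :=
  ∀ f : X.Cell,
    (∃ h, X.cellOf h = f ∧ ∀ x, X.attach x = X.attach h → Ψ.height x ≤ Ψ.height h) ∧
    (∃ l, X.cellOf l = f ∧ ∀ x, X.attach x = X.attach l → Ψ.height l ≤ Ψ.height x)

/-- The sides `s` and `s'` lie along the same 1-cell, and over the interior of this 1-cell `s` is
lower than `s'`. -/
def Lower (s s' : X.Side) : Prop :=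
  (X.sideDart s' = X.sideDart s ∨ X.sideDart s' = X.inv (X.sideDart s)) ∧
  ∀ t ∈ Set.Ioo (0 : I) 1, ∀ t' ∈ Set.Ioo (0 : I) 1,
    X.attach (X.sidePoint s t) = X.attach (X.sidePoint s' t') →
      Ψ.height (X.sidePoint s t) < Ψ.height (X.sidePoint s' t')

/-- The vertices of the dual graph are the 2-cells. -/
@[nolint unusedArguments]
def DualGraph (_ : X.Stacking) : Type w := X.Cell

/-- The edges of the dual graph, directed by the stacking: for each pair of sides along a common
1-cell, an edge from the 2-cell of the lower side to the 2-cell of the higher side. -/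
instance : Quiver Ψ.DualGraph where
  Hom r₁ r₂ := { p : ZMod (X.len r₁) × ZMod (X.len r₂) // Ψ.Lower ⟨r₁, p.1⟩ ⟨r₂, p.2⟩ }

end Stacking

end TwoComplex

/-- A directed graph is acyclic if it has no directed cycle, that is, no closed directed path of
positive length. -/
def Quiver.IsAcyclicDigraph (V : Type*) [Quiver V] : Prop :=
  ∀ (a : V) (p : Quiver.Path a a), p.length = 0

/-- A disk diagram: a finite cell structure on the 2-sphere with one open 2-cell (the outer face)
removed. The embedding in the sphere is recorded by the rotation system `rot`, which sends each
dart to the next one in the cyclic order of the darts starting at the same vertex. The faces of the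
embedding are the cycles of `d ↦ rot (inv d)`. The 2-cells are all the faces but one, with their
boundary paths read in the orientation of the sphere. -/
structure DiskDiagram extends TwoComplex.{u, v, w} where
  finite_vertex : Finite Vertex
  finite_dart : Finite Dart
  finite_cell : Finite Cell
  nonempty_vertex : Nonempty Vertex
  connected : ∀ x y : Vertex,
    Relation.ReflTransGen (fun a b => ∃ d, source d = a ∧ source (inv d) = b) x y
  rot : Equiv.Perm Dart
  /-- The cycles of `rot` are the sets of darts starting at a common vertex. -/
  rot_sameCycle : ∀ d d', rot.SameCycle d d' ↔ source d = source d'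
  /-- The boundary path of a 2-cell runs along a face. -/
  bd_next : ∀ f i, bd f (i + 1) = rot (inv (bd f i))
  /-- Distinct 2-cells are distinct faces, and a boundary path runs once around its face. -/
  bd_injective : ∀ f i f' i', bd f i = bd f' i' →
    (⟨f, i⟩ : Σ f : Cell, ZMod (len f)) = ⟨f', i'⟩
  /-- The darts on no boundary path form exactly one face, the outer face (with the empty boundary
  path if the diagram is a single vertex). -/
  outer : IsEmpty Dart ∨ ∃ d₀, ∀ d,
    (∀ f i, bd f i ≠ d) ↔
      Equiv.Perm.SameCycle (rot * (⟨inv, inv, inv_inv, inv_inv⟩ : Equiv.Perm Dart)) d₀ d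
  /-- Euler's formula `V - E + F = 2` for the sphere, with `E` half the number of darts and `F` the
  number of 2-cells plus one. -/
  euler : (Nat.card Vertex : ℚ) - (Nat.card Dart : ℚ) / 2 + ((Nat.card Cell : ℚ) + 1) = 2

/-! A closed path in the dual graph, recorded by the 1-cells it crosses, is an antisymmetric
function `φ` on darts that is positive only on ascending darts and sums to zero around every 2-cell
(`exists_flow`). By vanishing of first cohomology, `φ` is the coboundary of a vertex potential `g`
(`exists_eq_coboundary`). Darts on the outer face and their reverses are never ascending, so `g` is
constant along that face.

Immersed boundaries keep the two sides of a 1-cell disjoint, so one side is lower over the whole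
closed 1-cell. Hence the corner heights around an interior vertex have a strict rise and a strict
fall, and the link of the vertex is not an oriented cycle. Goodness says the same of the boundary of
an interior 2-cell. Under these two conditions an Euler characteristic count in the style of
Poincaré–Hopf forbids `g` to exceed its outer value (`le_source_of_orientation`). Applied to `g` and
`-g`, this makes `g` constant and `φ = 0`. But the crossings of a path of positive length cannot
cancel, since the two darts of a 1-cell are never both ascending. -/

namespace DiskDiagram

variable (D : DiskDiagram.{u, v, w})

/-! ### Darts, faces, boundaries and coboundaries -/

noncomputable instance : Fintype D.Vertex := @Fintype.ofFinite _ D.finite_vertex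
noncomputable instance : Fintype D.Dart := @Fintype.ofFinite _ D.finite_dart
noncomputable instance : Fintype D.Cell := @Fintype.ofFinite _ D.finite_cell

instance (f : D.Cell) : NeZero (D.len f) := ⟨(D.len_pos f).ne'⟩

/-- The reversal of darts as a permutation. -/
def invPerm : Equiv.Perm D.Dart := ⟨D.inv, D.inv, D.inv_inv, D.inv_inv⟩

theorem inv_injective : Function.Injective D.inv := D.invPerm.injective

theorem source_rot (d : D.Dart) : D.source (D.rot d) = D.source d :=
  ((D.rot_sameCycle _ _).1 ⟨1, by simp⟩).symm

theorem target_inv (d : D.Dart) : D.target (D.inv d) = D.source d :=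
  congrArg D.source (D.inv_inv d)

/-- The side of a 2-cell is determined by the dart it traverses. -/
theorem sideDart_injective : Function.Injective D.sideDart :=
  fun s s' h => D.bd_injective s.1 s.2 s'.1 s'.2 h

/-- A dart is inner if it is traversed by the boundary path of a 2-cell. -/
def IsInner (d : D.Dart) : Prop := ∃ s, D.sideDart s = d

theorem exists_bd_of_isInner_rot_inv {d : D.Dart} {f : D.Cell} {i : ZMod (D.len f)}
    (h : D.rot (D.inv d) = D.bd f i) : D.bd f (i - 1) = d := by
  have h1 := D.bd_next f (i - 1)
  rw [sub_add_cancel, ← h] at h1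
  exact (D.inv_injective (D.rot.injective h1)).symm

theorem isInner_rot_inv (d : D.Dart) : D.IsInner (D.rot (D.inv d)) ↔ D.IsInner d := by
  constructor
  · rintro ⟨s, hs⟩
    exact ⟨⟨s.1, s.2 - 1⟩, D.exists_bd_of_isInner_rot_inv hs.symm⟩
  · rintro ⟨s, rfl⟩
    exact ⟨⟨s.1, s.2 + 1⟩, D.bd_next s.1 s.2⟩

/-- The function on darts that is constant along each face, with given values on the 2-cells and
with value `0` on the outer face. -/
noncomputable def faceFun : (D.Cell → ℚ) →ₗ[ℚ] (D.Dart → ℚ) where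
  toFun z := Function.extend D.sideDart (fun s => z s.1) 0
  map_add' z z' := by
    funext d
    by_cases h : ∃ s, D.sideDart s = d
    · obtain ⟨s, rfl⟩ := h
      simp [D.sideDart_injective.extend_apply]
    · simp [Function.extend_apply' _ _ _ h]
  map_smul' c z := by
    funext d
    by_cases h : ∃ s, D.sideDart s = d
    · obtain ⟨s, rfl⟩ := h
      simp [D.sideDart_injective.extend_apply]
    · simp [Function.extend_apply' _ _ _ h]

theorem faceFun_sideDart (z : D.Cell → ℚ) (s : D.Side) : D.faceFun z (D.sideDart s) = z s.1 :=
  D.sideDart_injective.extend_apply (fun s => z s.1) (0 : D.Dart → ℚ) s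

theorem faceFun_bd (z : D.Cell → ℚ) (f : D.Cell) (i : ZMod (D.len f)) :
    D.faceFun z (D.bd f i) = z f :=
  D.faceFun_sideDart z ⟨f, i⟩

theorem faceFun_of_not_isInner (z : D.Cell → ℚ) {d : D.Dart} (h : ¬ D.IsInner d) :
    D.faceFun z d = 0 :=
  Function.extend_apply' (fun s : D.Side => z s.1) (0 : D.Dart → ℚ) d h

theorem faceFun_rot_inv (z : D.Cell → ℚ) (d : D.Dart) :
    D.faceFun z (D.rot (D.inv d)) = D.faceFun z d := by
  by_cases h : D.IsInner d
  · obtain ⟨s, rfl⟩ := h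
    change D.faceFun z (D.rot (D.inv (D.bd s.1 s.2))) = D.faceFun z (D.bd s.1 s.2)
    rw [← D.bd_next, faceFun_bd, faceFun_bd]
  · rw [D.faceFun_of_not_isInner z h,
      D.faceFun_of_not_isInner z (fun h' => h ((D.isInner_rot_inv d).1 h'))]

theorem faceFun_rot (z : D.Cell → ℚ) (d : D.Dart) :
    D.faceFun z (D.rot d) = D.faceFun z (D.inv d) := by
  rw [← D.faceFun_rot_inv z (D.inv d), D.inv_inv]

/-- The coboundary of a function on vertices. -/
def coboundary : (D.Vertex → ℚ) →ₗ[ℚ] (D.Dart → ℚ) where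
  toFun g d := g (D.target d) - g (D.source d)
  map_add' g g' := by funext d; simp; ring
  map_smul' c g := by funext d; simp; ring

/-- The boundary of a combination of 2-cells. -/
noncomputable def boundary : (D.Cell → ℚ) →ₗ[ℚ] (D.Dart → ℚ) where
  toFun z d := D.faceFun z d - D.faceFun z (D.inv d)
  map_add' g g' := by funext d; simp; ring
  map_smul' c g := by funext d; simp; ring

theorem coboundary_apply (g : D.Vertex → ℚ) (d : D.Dart) :
    D.coboundary g d = g (D.target d) - g (D.source d) := rfl

theorem boundary_apply (z : D.Cell → ℚ) (d : D.Dart) :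
    D.boundary z d = D.faceFun z d - D.faceFun z (D.inv d) := rfl

theorem coboundary_inv (g : D.Vertex → ℚ) (d : D.Dart) :
    D.coboundary g (D.inv d) = - D.coboundary g d := by
  rw [coboundary_apply, coboundary_apply, target_inv]
  change _ - g (D.target d) = _
  ring

theorem boundary_inv (z : D.Cell → ℚ) (d : D.Dart) :
    D.boundary z (D.inv d) = - D.boundary z d := by
  rw [boundary_apply, boundary_apply, D.inv_inv]
  ring

theorem sum_inv (F : D.Dart → ℚ) : ∑ d, F (D.inv d) = ∑ d, F d := Equiv.sum_comp D.invPerm F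

/-- Coboundaries are orthogonal to boundaries. -/
theorem sum_coboundary_mul_boundary (g : D.Vertex → ℚ) (z : D.Cell → ℚ) :
    ∑ d, D.coboundary g d * D.boundary z d = 0 := by
  have h1 : ∑ d, g (D.source d) * D.boundary z d = 0 := by
    -- The face on the far side of `d` is the face of `rot d`, which has the same source, so
    -- reindexing by `rot` matches the two halves of the boundary.
    have h2 : ∑ d, g (D.source d) * D.faceFun z (D.inv d)
        = ∑ d, g (D.source d) * D.faceFun z d := by
      rw [← Equiv.sum_comp D.rot (fun d => g (D.source d) * D.faceFun z d)]
      refine Finset.sum_congr rfl fun d _ => ?_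
      rw [source_rot, faceFun_rot]
    simp only [boundary_apply, mul_sub, Finset.sum_sub_distrib, h2, sub_self]
  have h3 : ∑ d, g (D.target d) * D.boundary z d = 0 := by
    rw [← sum_inv]
    simp only [target_inv, boundary_inv, mul_neg, Finset.sum_neg_distrib, h1, neg_zero]
  simp only [coboundary_apply, sub_mul, Finset.sum_sub_distrib, h1, h3, sub_self]

/-! ### Propagation along edges, around vertices and along the outer face -/

/-- A function on vertices that is invariant along darts is constant. -/
theorem eq_of_forall_dart {α : Type*} (g : D.Vertex → α)
    (h : ∀ d, g (D.target d) = g (D.source d)) (x y : D.Vertex) : g x = g y := by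
  induction D.connected x y with
  | refl => rfl
  | tail _ hd ih =>
    obtain ⟨d, rfl, rfl⟩ := hd
    exact ih.trans (h d).symm

/-- A function on darts that is invariant under rotation depends only on the source. -/
theorem eq_of_source_eq {α : Type*} (Y : D.Dart → α) (P : D.Vertex → Prop)
    (h : ∀ d, P (D.source d) → Y (D.rot d) = Y d) {d d' : D.Dart} (hP : P (D.source d))
    (hs : D.source d = D.source d') : Y d = Y d' := by
  obtain ⟨n, rfl⟩ := ((D.rot_sameCycle d d').2 hs).exists_nat_pow_eq
  clear hs
  induction n with
  | zero => rfl
  | succ n ih =>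
    rw [pow_succ', Equiv.Perm.mul_apply]
    have hsrc : D.source ((D.rot ^ n) d) = D.source d :=
      ((D.rot_sameCycle _ _).1 ⟨n, by simp⟩).symm
    rw [h _ (by rwa [hsrc]), ← ih]

/-- If a dart is not inner, the darts that are not inner form one face. -/
theorem outer_induction {o : D.Dart} (ho : ¬ D.IsInner o) (P : D.Vertex → Prop)
    (h0 : P (D.source o)) (h : ∀ d, ¬ D.IsInner d → P (D.source d) → P (D.target d))
    {d : D.Dart} (hd : ¬ D.IsInner d) : P (D.source d) := by
  have key : ∀ d, (∀ f i, D.bd f i ≠ d) ↔ ¬ D.IsInner d := fun d =>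
    ⟨fun h ⟨s, hs⟩ => h s.1 s.2 hs, fun h f i hi => h ⟨⟨f, i⟩, hi⟩⟩
  rcases D.outer with he | ⟨d₀, hd₀⟩
  · exact he.elim o
  have hc : Equiv.Perm.SameCycle (D.rot * D.invPerm) o d :=
    (((hd₀ o).1 ((key o).2 ho)).symm).trans ((hd₀ d).1 ((key d).2 hd))
  obtain ⟨n, rfl⟩ := hc.exists_nat_pow_eq
  clear hc hd
  have : ∀ n : ℕ, ¬ D.IsInner (((D.rot * D.invPerm) ^ n) o) ∧
      P (D.source (((D.rot * D.invPerm) ^ n) o)) := by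
    intro n
    induction n with
    | zero => exact ⟨ho, h0⟩
    | succ n ih =>
      rw [pow_succ', Equiv.Perm.mul_apply]
      generalize ((D.rot * D.invPerm) ^ n) o = e at ih
      change ¬ D.IsInner (D.rot (D.inv e)) ∧ P (D.source (D.rot (D.inv e)))
      rw [isInner_rot_inv, source_rot]
      exact ⟨ih.1, h e ih.1 ih.2⟩
  exact (this n).2

theorem exists_not_isInner (d : D.Dart) : ∃ o, ¬ D.IsInner o := by
  rcases D.outer with he | ⟨d₀, hd₀⟩
  · exact he.elim d
  · exact ⟨d₀, fun ⟨s, hs⟩ => (hd₀ d₀).2 (Equiv.Perm.SameCycle.refl _ _) s.1 s.2 hs⟩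

/-- There is an orientation of the 1-cells. -/
theorem exists_orientation : ∃ O : Set D.Dart, ∀ d, D.inv d ∈ O ↔ d ∉ O := by
  refine ⟨{d | Fintype.equivFin D.Dart d < Fintype.equivFin D.Dart (D.inv d)}, fun d => ?_⟩
  simp only [Set.mem_ofPred_eq, D.inv_inv, not_lt]
  refine ⟨le_of_lt, fun h => lt_of_le_of_ne h fun h' => ?_⟩
  exact D.inv_ne d ((Fintype.equivFin D.Dart).injective h')

/-- Reversal exchanges `E ∩ O` and `E \ O`. The orientation condition is only required on `E`,
because ascending darts orient only inner 1-cells. -/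
theorem two_mul_card_inter_orientation {O E : Set D.Dart}
    (hO : ∀ d ∈ E, (D.inv d ∈ O ↔ d ∉ O)) (hE : ∀ d, D.inv d ∈ E ↔ d ∈ E) :
    2 * Nat.card ↥(E ∩ O) = Nat.card E := by
  have h1 : Nat.card ↥(E ∩ O) = Nat.card ↥(E \ O) := by
    refine Nat.card_congr (D.invPerm.subtypeEquiv fun d => ?_)
    change d ∈ E ∧ d ∈ O ↔ D.inv d ∈ E ∧ D.inv d ∉ O
    rw [hE]
    exact and_congr_right fun hd => by rw [hO d hd, not_not]
  have h2 := Set.ncard_inter_add_ncard_sdiff_eq_ncard E O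
  rw [Nat.card_coe_set_eq, Nat.card_coe_set_eq] at h1
  rw [Nat.card_coe_set_eq, Nat.card_coe_set_eq]
  omega

/-! ### Dimension counts by orthogonality of `δ` and `∂` -/

/-- The map `(g, z) ↦ δg + ∂z` on functions supported on a set of vertices and a set of 2-cells,
with values restricted to a set of darts. -/
noncomputable def hodgeMap (C : Set D.Vertex) (F : Set D.Cell) (E : Set D.Dart) :
    ((C → ℚ) × (F → ℚ)) →ₗ[ℚ] (E → ℚ) :=
  (LinearMap.funLeft ℚ ℚ ((↑) : E → D.Dart)) ∘ₗ
    (LinearMap.coprod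
      (D.coboundary ∘ₗ Function.ExtendByZero.linearMap ℚ ((↑) : C → D.Vertex))
      (D.boundary ∘ₗ Function.ExtendByZero.linearMap ℚ ((↑) : F → D.Cell)))

/-- Orthogonality of `δg` and `∂z` over all darts forces `δg = 0`, although their sum is only known
to vanish on `E`: `δg` is supported on the 1-cells that meet `C`, and `hC` says these are covered by
`E`. Then `g` is constant, and zero because it vanishes at a vertex outside `C`. -/
theorem hodgeMap_injective (C : Set D.Vertex) (F : Set D.Cell) (E : Set D.Dart)
    (hC : ∀ d, D.source d ∈ C → d ∈ E ∨ D.inv d ∈ E) (hC' : ∃ x, x ∉ C)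
    (hF : ∀ z : D.Cell → ℚ, (∀ d, d ∈ E ∨ D.inv d ∈ E →
      D.faceFun z d = D.faceFun z (D.inv d)) → ∀ f ∈ F, z f = 0) :
    Function.Injective (D.hodgeMap C F E) := by
  rw [← LinearMap.ker_eq_bot, LinearMap.ker_eq_bot']
  rintro ⟨g, z⟩ h
  set G : D.Vertex → ℚ := Function.extend (↑) g 0
  set Z : D.Cell → ℚ := Function.extend (↑) z 0
  have h0 : ∀ d, d ∈ E ∨ D.inv d ∈ E → D.coboundary G d + D.boundary Z d = 0 := by
    have h1 : ∀ d ∈ E, D.coboundary G d + D.boundary Z d = 0 := fun d hd =>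
      congrFun h ⟨d, hd⟩
    rintro d (hd | hd)
    · exact h1 d hd
    · have := h1 _ hd
      rw [coboundary_inv, boundary_inv] at this
      linarith
  have hGC : ∀ x, x ∉ C → G x = 0 := fun x hx =>
    Function.extend_apply' _ _ _ (by rintro ⟨y, rfl⟩; exact hx y.2)
  have h2 : ∀ d, D.coboundary G d * D.coboundary G d
      + D.coboundary G d * D.boundary Z d = 0 := by
    intro d
    rw [← mul_add]
    by_cases hd : D.source d ∈ C
    · rw [h0 d (hC d hd), mul_zero]
    by_cases hd' : D.target d ∈ C
    · have := hC (D.inv d) hd'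
      rw [D.inv_inv] at this
      rw [h0 d this.symm, mul_zero]
    · rw [coboundary_apply, hGC _ hd, hGC _ hd', sub_zero, zero_mul]
  have h3 : ∑ d, D.coboundary G d * D.coboundary G d = 0 := by
    have := Finset.sum_congr (rfl : (Finset.univ : Finset D.Dart) = _) fun d _ => h2 d
    rw [Finset.sum_add_distrib, sum_coboundary_mul_boundary, add_zero,
      Finset.sum_const_zero] at this
    exact this
  have h4 : ∀ d, D.coboundary G d = 0 := by
    intro d
    have := (Finset.sum_eq_zero_iff_of_nonneg (fun d _ => mul_self_nonneg _)).1 h3 d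
      (Finset.mem_univ d)
    exact mul_self_eq_zero.1 this
  have h5 : ∀ x, G x = 0 := by
    obtain ⟨y, hy⟩ := hC'
    intro x
    rw [← hGC y hy]
    exact D.eq_of_forall_dart G (fun d => sub_eq_zero.1 (h4 d)) x y
  have h6 : ∀ f ∈ F, Z f = 0 := by
    refine hF Z fun d hd => ?_
    have := h0 d hd
    rw [h4, zero_add, boundary_apply] at this
    exact sub_eq_zero.1 this
  refine Prod.ext (funext fun x => ?_) (funext fun f => ?_)
  · exact (Subtype.val_injective.extend_apply g 0 x).symm.trans (h5 x)
  · exact (Subtype.val_injective.extend_apply z 0 f).symm.trans (h6 f f.2)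

theorem finrank_hodge (C : Set D.Vertex) (F : Set D.Cell) :
    Module.finrank ℚ ((C → ℚ) × (F → ℚ)) = Nat.card C + Nat.card F := by
  classical
  rw [Module.finrank_prod, Module.finrank_fintype_fun_eq_card, Module.finrank_fintype_fun_eq_card,
    Nat.card_eq_fintype_card, Nat.card_eq_fintype_card]

theorem finrank_dartFun (E : Set D.Dart) : Module.finrank ℚ (E → ℚ) = Nat.card E := by
  classical
  rw [Module.finrank_fintype_fun_eq_card, Nat.card_eq_fintype_card]

/-- Euler's formula, without fractions. -/
theorem two_mul_euler :
    2 * Nat.card D.Vertex + 2 * Nat.card D.Cell = Nat.card D.Dart + 2 := by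
  have h := D.euler
  have : (2 * Nat.card D.Vertex + 2 * Nat.card D.Cell : ℚ) = Nat.card D.Dart + 2 := by linarith
  exact_mod_cast this

/-! ### Vanishing of the first cohomology -/

/-- The first cohomology of the sphere vanishes: an antisymmetric function on darts which is
orthogonal to all boundaries of 2-cells is a coboundary. -/
theorem exists_eq_coboundary (φ : D.Dart → ℚ) (hφ : ∀ d, φ (D.inv d) = - φ d)
    (hz : ∀ z, ∑ d, φ d * D.faceFun z d = 0) : ∃ g, φ = D.coboundary g := by
  classical
  by_cases hD : IsEmpty D.Dart
  · exact ⟨0, funext fun d => hD.elim d⟩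
  rw [not_isEmpty_iff] at hD
  obtain ⟨d₁⟩ := hD
  obtain ⟨o, ho⟩ := D.exists_not_isInner d₁
  obtain ⟨O, hO⟩ := D.exists_orientation
  obtain ⟨x₀⟩ := D.nonempty_vertex
  have hmem : ∀ d, d ∈ O ∨ D.inv d ∈ O := fun d => by rw [hO]; exact em _
  -- Dropping `x₀` removes the constants from the kernel of `δ`. If `∂z = 0`, adjacent faces have
  -- equal values, and the value `0` of the outer face spreads everywhere by connectedness.
  have hinj : Function.Injective (D.hodgeMap {x₀}ᶜ Set.univ O) := by
    refine D.hodgeMap_injective _ _ _ (fun d _ => hmem d) ⟨x₀, by simp⟩ fun z hz f _ => ?_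
    have h1 : ∀ d d', D.source d = D.source d' → D.faceFun z d = D.faceFun z d' :=
      fun d d' => D.eq_of_source_eq _ (fun _ => True)
        (fun d _ => by rw [faceFun_rot, hz d (hmem d)]) trivial
    have h2 : ∀ x, ∀ d, D.source d = x → D.faceFun z d = 0 := by
      have : ∀ x, D.source o = x ∨ (∃ d, D.source d = x) → (∀ d, D.source d = x →
          D.faceFun z d = 0) := by
        intro x _
        induction D.connected (D.source o) x with
        | refl => exact fun d hd => by rw [h1 d o hd, D.faceFun_of_not_isInner z ho]
        | tail _ he ih =>
          obtain ⟨e, rfl, rfl⟩ := he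
          intro d hd
          rw [h1 d _ hd, ← hz e (hmem e)]
          exact ih (Or.inr ⟨e, rfl⟩) e rfl
      exact fun x d hd => this x (Or.inr ⟨d, hd⟩) d hd
    rw [← D.faceFun_bd z f 0]
    exact h2 _ _ rfl
  -- Euler's formula reads `(V - 1) + (F - 1) = E`, so the injective map is onto.
  have hcard : Module.finrank ℚ ((↥({x₀}ᶜ : Set D.Vertex) → ℚ) × (↥(Set.univ : Set D.Cell) → ℚ))
      = Module.finrank ℚ (O → ℚ) := by
    rw [finrank_hodge, finrank_dartFun]
    have h1 := D.two_mul_card_inter_orientation (E := Set.univ) (fun d _ => hO d) (by simp)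
    have h2 := D.two_mul_euler
    have h3 := Set.ncard_add_ncard_compl ({x₀} : Set D.Vertex)
    rw [Set.univ_inter, Nat.card_univ] at h1
    rw [Set.ncard_singleton] at h3
    rw [Nat.card_univ, Nat.card_coe_set_eq]
    omega
  obtain ⟨⟨g, z⟩, hgz⟩ := (LinearMap.injective_iff_surjective_of_finrank_eq_finrank hcard).1 hinj
    (fun d => φ d)
  set G : D.Vertex → ℚ := Function.extend (↑) g 0
  set Z : D.Cell → ℚ := Function.extend (↑) z 0
  have h1 : ∀ d, φ d = D.coboundary G d + D.boundary Z d := by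
    have h0 : ∀ d ∈ O, φ d = D.coboundary G d + D.boundary Z d := fun d hd =>
      (congrFun hgz ⟨d, hd⟩).symm
    intro d
    rcases hmem d with hd | hd
    · exact h0 d hd
    · have := h0 _ hd
      rw [hφ, coboundary_inv, boundary_inv] at this
      linarith
  have h2 : ∑ d, φ d * D.boundary Z d = 0 := by
    have : ∑ d, φ d * D.faceFun Z (D.inv d) = 0 := by
      rw [← sum_inv]
      simp only [hφ, D.inv_inv, neg_mul, Finset.sum_neg_distrib, hz, neg_zero]
    simp only [boundary_apply, mul_sub, Finset.sum_sub_distrib, hz, this, sub_self]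
  -- Both `φ` and `δG` are orthogonal to `∂Z`, hence so is their difference `∂Z` itself.
  have h3 : ∑ d, D.boundary Z d * D.boundary Z d = 0 := by
    rw [← h2]
    simp only [h1, add_mul, Finset.sum_add_distrib, sum_coboundary_mul_boundary, zero_add]
  refine ⟨G, funext fun d => ?_⟩
  have h4 := (Finset.sum_eq_zero_iff_of_nonneg (fun d _ => mul_self_nonneg _)).1 h3 d
    (Finset.mem_univ d)
  rw [h1 d, mul_self_eq_zero.1 h4, add_zero]

/-! ### A maximum principle from Euler's formula -/

/-- Let `U` orient the inner 1-cells of a disk diagram such that no vertex and no 2-cell away from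
the outer face has an oriented cycle as its link or boundary. A function on vertices which is
constant on the outer face and which decreases only along darts in `U` attains its maximum on the
outer face. -/
theorem le_source_of_orientation (U : D.Dart → Prop) (g : D.Vertex → ℚ)
    (hU : ∀ d, D.IsInner d → D.IsInner (D.inv d) → (U (D.inv d) ↔ ¬ U d))
    (hg : ∀ d, g (D.target d) < g (D.source d) → U d)
    (hg' : ∀ d, ¬ D.IsInner d → g (D.target d) = g (D.source d))
    (hv : ∀ x, (∀ d, D.source d = x → D.IsInner d ∧ D.IsInner (D.inv d)) →
      (∃ d, D.source d = x) → ∃ d, D.source d = x ∧ ¬ U d ∧ U (D.rot d))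
    (hf : ∀ f, (∀ i, D.IsInner (D.inv (D.bd f i))) →
      ∃ i, U (D.bd f i) ∧ ¬ U (D.bd f (i + 1)))
    (o : D.Dart) (ho : ¬ D.IsInner o) (y : D.Vertex) : g y ≤ g (D.source o) := by
  classical
  by_contra! hy
  -- `C` is the component of `D.source o` in the sublevel set `g ≤ g (D.source o)`. It contains the
  -- outer face and misses `y`. Every edge entering `C` from outside descends, hence lies in `U`.
  set r : D.Vertex → D.Vertex → Prop := fun a b =>
    (∃ d, D.source d = a ∧ D.source (D.inv d) = b) ∧ g b ≤ g (D.source o)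
  set C : Set D.Vertex := {x | Relation.ReflTransGen r (D.source o) x}
  have hCo : D.source o ∈ C := Relation.ReflTransGen.refl
  have hCg : ∀ x ∈ C, g x ≤ g (D.source o) := by
    intro x hx
    rcases Relation.ReflTransGen.cases_tail hx with h | ⟨_, _, h⟩
    · rw [h]
    · exact h.2
  have hCstep : ∀ d, D.source d ∈ C → g (D.target d) ≤ g (D.source o) → D.target d ∈ C :=
    fun d hd h => Relation.ReflTransGen.tail hd ⟨⟨d, rfl, rfl⟩, h⟩
  have hCb : ∀ d, D.source d ∉ C → D.target d ∈ C → U d := by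
    intro d hd hd'
    refine hg d ((hCg _ hd').trans_lt ?_)
    by_contra! h
    apply hd
    have := hCstep (D.inv d) hd'
    rw [target_inv] at this
    exact this h
  have hCout : ∀ d, ¬ D.IsInner d → D.source d ∈ C := by
    intro d hd
    refine D.outer_induction ho (· ∈ C) hCo (fun d hd h => hCstep d h ?_) hd
    rw [hg' d hd]
    exact hCg _ h
  have hin : ∀ d, D.source d ∉ C → D.IsInner d ∧ D.IsInner (D.inv d) := by
    intro d hd
    refine ⟨by_contra fun h => hd (hCout d h), by_contra fun h => hd ?_⟩
    rw [← isInner_rot_inv, D.inv_inv] at h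
    rw [← source_rot]
    exact hCout _ h
  set E : Set D.Dart := {d | D.source d ∈ C ∨ D.target d ∈ C}
  set F : Set D.Cell := {f | ∃ i, D.source (D.bd f i) ∈ C}
  have hEinv : ∀ d, D.inv d ∈ E ↔ d ∈ E := by
    intro d
    change D.target d ∈ C ∨ D.target (D.inv d) ∈ C ↔ D.source d ∈ C ∨ D.target d ∈ C
    rw [target_inv, or_comm]
  obtain ⟨O, hO⟩ := D.exists_orientation
  have hmem : ∀ d ∈ E, d ∈ E ∩ O ∨ D.inv d ∈ E ∩ O := by
    intro d hd
    by_cases h : d ∈ O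
    · exact Or.inl ⟨hd, h⟩
    · exact Or.inr ⟨(hEinv d).2 hd, (hO d).2 h⟩
  -- Vertices of `C` and 2-cells touching `C` are at most as many as the 1-cells touching `C`.
  -- Injectivity holds because `C` misses `y` and the value `0` of the outer face spreads along the
  -- connected set `C`.
  have hlow : Nat.card C + Nat.card F ≤ Nat.card ↥(E ∩ O) := by
    rw [← finrank_hodge, ← finrank_dartFun]
    refine LinearMap.finrank_le_finrank_of_injective (f := D.hodgeMap C F (E ∩ O))
      (D.hodgeMap_injective _ _ _ (fun d hd => hmem d (Or.inl hd))
        ⟨y, fun h => (hCg y h).not_gt hy⟩ ?_)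
    intro z hz
    have h1 : ∀ d d', D.source d ∈ C → D.source d = D.source d' →
        D.faceFun z d = D.faceFun z d' :=
      fun d d' => D.eq_of_source_eq _ (· ∈ C)
        (fun d hd => by rw [faceFun_rot, hz d (hmem d (Or.inl hd))])
    have h2 : ∀ x ∈ C, ∀ d, D.source d = x → D.faceFun z d = 0 := by
      intro x hx
      induction hx with
      | refl => exact fun d hd => by rw [h1 d o (hd ▸ hCo) hd, D.faceFun_of_not_isInner z ho]
      | tail ha he ih =>
        have hb := Relation.ReflTransGen.tail ha he
        obtain ⟨⟨e, rfl, rfl⟩, -⟩ := he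
        intro d hd
        rw [h1 d (D.inv e) (hd ▸ hb) hd, ← hz e (hmem e (Or.inl ha))]
        exact ih e rfl
    rintro f ⟨i, hi⟩
    rw [← D.faceFun_bd z f i]
    exact h2 _ hi _ rfl
  have hUC : ∀ d ∈ Eᶜ, (D.inv d ∈ {d | ¬ U d} ↔ d ∉ {d | ¬ U d}) := by
    intro d hd
    have h := hin d (fun h => hd (Or.inl h))
    change ¬ U (D.inv d) ↔ ¬ ¬ U d
    rw [hU d h.1 h.2]
  -- The same inequality holds away from `C`: each vertex and each 2-cell there claims its own
  -- 1-cell, at a place where the orientation changes in its link or boundary. Adding the two bounds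
  -- gives `V + (F - 1) ≤ E`, one less than Euler's formula.
  have hhigh : Nat.card ↥Cᶜ + Nat.card ↥Fᶜ ≤ Nat.card ↥(Eᶜ ∩ {d | ¬ U d}) := by
    have hdart : ∀ x ∉ C, ∃ d, D.source d = x := by
      intro x hx
      rcases Relation.ReflTransGen.cases_head (D.connected x (D.source o)) with h | ⟨_, ⟨d, h, _⟩, _⟩
      · exact absurd (h ▸ hCo) hx
      · exact ⟨d, h⟩
    have hva : ∀ x : ↥Cᶜ, ∃ d, D.source d = x ∧ ¬ U d ∧ U (D.rot d) := fun x =>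
      hv x (fun d hd => hin d (by rw [hd]; exact x.2)) (hdart x x.2)
    have hfa : ∀ f : ↥Fᶜ, ∃ i, U (D.bd f i) ∧ ¬ U (D.bd f (i + 1)) := fun f =>
      hf f fun i => (hin _ fun h => f.2 ⟨i, h⟩).2
    choose a ha1 ha2 ha3 using hva
    choose i hi1 hi2 using hfa
    have hamem : ∀ x, a x ∈ Eᶜ ∩ {d | ¬ U d} := fun x =>
      ⟨by
        rintro (h | h)
        · rw [ha1] at h
          exact x.2 h
        · exact ha2 x (hCb _ (by rw [ha1]; exact x.2) h), ha2 x⟩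
    have hbmem : ∀ f : ↥Fᶜ, D.inv (D.bd f (i f)) ∈ Eᶜ ∩ {d | ¬ U d} := by
      intro f
      have hs : ∀ j, D.source (D.bd f j) ∉ C := fun j h => f.2 ⟨j, h⟩
      have h2 := hin _ (hs (i f))
      refine ⟨?_, fun h => (hU _ h2.1 h2.2).1 h (hi1 f)⟩
      rintro (h | h)
      · rw [D.bd_closed] at h
        exact hs _ h
      · rw [target_inv] at h
        exact hs _ h
    rw [← Nat.card_sum]
    refine Nat.card_le_card_of_injective
      (Sum.elim (fun x => ⟨a x, hamem x⟩) (fun f => ⟨D.inv (D.bd f (i f)), hbmem f⟩) :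
        ↥Cᶜ ⊕ ↥Fᶜ → ↥(Eᶜ ∩ {d | ¬ U d})) ?_
    -- If a vertex and a 2-cell claimed the same dart, the next dart by `rot` would be in `U` for
    -- the vertex and not in `U` for the 2-cell.
    have hne : ∀ (x : ↥Cᶜ) (f : ↥Fᶜ), a x ≠ D.inv (D.bd f (i f)) := by
      intro x f h
      have := ha3 x
      rw [h, ← D.bd_next] at this
      exact hi2 f this
    rintro (x | f) (x' | f') h
    · have h' : a x = a x' := congrArg Subtype.val h
      refine congrArg Sum.inl (Subtype.ext ?_)
      rw [← ha1 x, ← ha1 x', h']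
    · exact absurd (congrArg Subtype.val h) (hne x f')
    · exact absurd (congrArg Subtype.val h).symm (hne x' f)
    · have h' : D.inv (D.bd f (i f)) = D.inv (D.bd f' (i f')) := congrArg Subtype.val h
      have h2 := D.bd_injective _ _ _ _ (D.inv_injective h')
      exact congrArg Sum.inr (Subtype.ext (congrArg Sigma.fst h2))
  have c1 := D.two_mul_card_inter_orientation (fun d _ => hO d) hEinv
  have c2 := D.two_mul_card_inter_orientation (E := Eᶜ) hUC fun d => not_congr (hEinv d)
  have c3 := D.two_mul_euler
  have c4 := Set.ncard_add_ncard_compl C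
  have c5 := Set.ncard_add_ncard_compl F
  have c6 := Set.ncard_add_ncard_compl E
  simp only [← Nat.card_coe_set_eq] at c4 c5 c6
  omega

end DiskDiagram

/-! ### The two sides of a 1-cell in a stacking -/

namespace TwoComplex

variable (X : TwoComplex.{u, v, w})

open Classical in
/-- The normal form of a point of a subdivided boundary circle: a corner is regarded as the start
of a side. -/
noncomputable def cornerForm (p : Σ _ : X.Side, I) : Σ _ : X.Side, I :=
  if p.2 = 1 then ⟨⟨p.1.1, p.1.2 + 1⟩, 0⟩ else p

/-- The normal form is an invariant of the gluing, so it detects that two points of the circles are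
distinct. -/
theorem cornerForm_eq_of_sidePoint_eq {s s' : X.Side} {t t' : I}
    (h : X.sidePoint s t = X.sidePoint s' t') :
    X.cornerForm ⟨s, t⟩ = X.cornerForm ⟨s', t'⟩ := by
  refine congrArg (Quot.lift X.cornerForm ?_) h
  rintro _ _ ⟨f, i⟩
  simp [cornerForm]

theorem sidePoint_one (s : X.Side) : X.sidePoint s 1 = X.sidePoint ⟨s.1, s.2 + 1⟩ 0 :=
  Quot.sound (CircleRel.corner s.1 s.2)

theorem continuous_sidePoint (s : X.Side) : Continuous (X.sidePoint s) :=
  continuous_quot_mk.comp continuous_sigmaMk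

theorem attach_sidePoint_symm {s s' : X.Side} (h : X.sideDart s' = X.inv (X.sideDart s)) (t : I) :
    X.attach (X.sidePoint s' (unitInterval.symm t)) = X.attach (X.sidePoint s t) := by
  change X.dartPoint (X.sideDart s') _ = X.dartPoint (X.sideDart s) t
  rw [h, dartPoint_symm]

/-- If the attaching maps are immersions, the two sides of a 1-cell are disjoint. -/
theorem HasImmersedBoundaries.sidePoint_ne {X : TwoComplex.{u, v, w}}
    (himm : X.HasImmersedBoundaries) {s s' : X.Side}
    (h : X.sideDart s' = X.inv (X.sideDart s)) (t : I) :
    X.sidePoint s t ≠ X.sidePoint s' (unitInterval.symm t) := by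
  intro he
  have hc := X.cornerForm_eq_of_sidePoint_eq he
  by_cases h0 : t = 0
  · subst h0
    simp only [cornerForm, zero_ne_one, if_false, unitInterval.symm_zero, if_true] at hc
    have hs : s = ⟨s'.1, s'.2 + 1⟩ := congrArg Sigma.fst hc
    refine himm s'.1 s'.2 ?_
    change X.sideDart ⟨s'.1, s'.2 + 1⟩ = X.inv (X.sideDart s')
    rw [← hs, h, X.inv_inv]
  by_cases h1 : t = 1
  · subst h1
    simp only [cornerForm, zero_ne_one, if_false, unitInterval.symm_one, if_true] at hc
    have hs : ⟨s.1, s.2 + 1⟩ = s' := congrArg Sigma.fst hc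
    refine himm s.1 s.2 ?_
    change X.sideDart ⟨s.1, s.2 + 1⟩ = X.inv (X.sideDart s)
    rw [hs, h]
  · have h1' : unitInterval.symm t ≠ 1 := fun h' => h0 (by
      rw [← unitInterval.symm_symm t, h', unitInterval.symm_one])
    simp only [cornerForm, h1, h1', if_false] at hc
    have hs : s = s' := congrArg Sigma.fst hc
    subst hs
    exact X.inv_ne _ h.symm

namespace Stacking

variable {X} (Ψ : X.Stacking)

theorem continuous_height_sidePoint (s : X.Side) :
    Continuous fun t => Ψ.height (X.sidePoint s t) :=
  continuous_snd.comp (Ψ.continuous_toFun.comp (X.continuous_sidePoint s))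

theorem height_ne {x y : X.BoundaryCircles} (h : X.attach x = X.attach y) (hne : x ≠ y) :
    Ψ.height x ≠ Ψ.height y := fun he =>
  hne (Ψ.injective_toFun (Prod.ext (by rw [Ψ.fst_toFun, Ψ.fst_toFun, h]) he))

/-- One of the two sides of a 1-cell is lower than the other over the whole closed 1-cell. -/
theorem forall_lt_or_forall_lt (himm : X.HasImmersedBoundaries) {s s' : X.Side}
    (h : X.sideDart s' = X.inv (X.sideDart s)) :
    (∀ t, Ψ.height (X.sidePoint s t) < Ψ.height (X.sidePoint s' (unitInterval.symm t))) ∨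
    (∀ t, Ψ.height (X.sidePoint s' (unitInterval.symm t)) < Ψ.height (X.sidePoint s t)) := by
  by_contra! hcon
  obtain ⟨⟨t₁, h₁⟩, ⟨t₂, h₂⟩⟩ := hcon
  have hcont : Continuous fun t => Ψ.height (X.sidePoint s t) -
      Ψ.height (X.sidePoint s' (unitInterval.symm t)) :=
    (Ψ.continuous_height_sidePoint s).sub
      ((Ψ.continuous_height_sidePoint s').comp unitInterval.continuous_symm)
  obtain ⟨t, ht⟩ := mem_range_of_exists_le_of_exists_ge hcont (c := 0)
    ⟨t₂, sub_nonpos.2 h₂⟩ ⟨t₁, sub_nonneg.2 h₁⟩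
  exact Ψ.height_ne (X.attach_sidePoint_symm h t).symm (himm.sidePoint_ne h t) (sub_eq_zero.1 ht)

/-- The dart `d` is ascending if both `d` and `inv d` are traversed by sides of 2-cells, and the
former side is lower than the latter. -/
def Ascending (d : X.Dart) : Prop :=
  ∃ s s', X.sideDart s = d ∧ X.sideDart s' = X.inv d ∧
    ∀ t, Ψ.height (X.sidePoint s t) < Ψ.height (X.sidePoint s' (unitInterval.symm t))

end Stacking

end TwoComplex

theorem ZMod.exists_and_not_add_one {n : ℕ} [NeZero n] (P : ZMod n → Prop) (h : ∃ i, P i)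
    (h' : ∃ i, ¬ P i) : ∃ i, P i ∧ ¬ P (i + 1) := by
  by_contra! hcon
  obtain ⟨i, hi⟩ := h
  obtain ⟨j, hj⟩ := h'
  have key : ∀ k : ℕ, P (i + k) := by
    intro k
    induction k with
    | zero => simpa using hi
    | succ k ih =>
      have := hcon _ ih
      rwa [add_assoc, ← Nat.cast_succ] at this
  apply hj
  have := key (j - i).val
  rwa [ZMod.natCast_zmod_val, add_sub_cancel] at this

/-! ### Ascending darts around vertices and 2-cells -/

namespace DiskDiagram

open TwoComplex

variable {D : DiskDiagram.{u, v, w}} (Ψ : D.toTwoComplex.Stacking)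

theorem isInner_of_ascending {d : D.Dart} (h : Ψ.Ascending d) :
    D.IsInner d ∧ D.IsInner (D.inv d) := by
  obtain ⟨s, s', hs, hs', -⟩ := h
  exact ⟨⟨s, hs⟩, ⟨s', hs'⟩⟩

theorem ascending_inv (himm : D.toTwoComplex.HasImmersedBoundaries) {d : D.Dart}
    (h : D.IsInner d) (h' : D.IsInner (D.inv d)) :
    Ψ.Ascending (D.inv d) ↔ ¬ Ψ.Ascending d := by
  obtain ⟨s, rfl⟩ := h
  obtain ⟨s', hs'⟩ := h'
  constructor
  · rintro ⟨a, a', ha, ha', hlt⟩ ⟨b, b', hb, hb', hlt'⟩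
    obtain rfl := D.sideDart_injective hb
    obtain rfl := D.sideDart_injective (ha'.trans (D.inv_inv _))
    obtain rfl := D.sideDart_injective (ha.trans hb'.symm)
    have h1 := hlt 0
    have h2 := hlt' 1
    rw [unitInterval.symm_zero] at h1
    rw [unitInterval.symm_one] at h2
    exact lt_asymm h1 h2
  · intro hna
    rcases Ψ.forall_lt_or_forall_lt himm hs' with h | h
    · exact absurd ⟨s, s', rfl, hs', h⟩ hna
    · refine ⟨s', s, hs', (D.inv_inv _).symm, fun t => ?_⟩
      have := h (unitInterval.symm t)
      rwa [unitInterval.symm_symm] at this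

/-- The height of the corner at the start of a dart. -/
noncomputable def cornerHeight (d : D.Dart) : ℝ :=
  Function.extend D.sideDart (fun s => Ψ.height (D.sidePoint s 0)) 0 d

theorem cornerHeight_sideDart (s : D.Side) :
    cornerHeight Ψ (D.sideDart s) = Ψ.height (D.sidePoint s 0) :=
  D.sideDart_injective.extend_apply (fun s => Ψ.height (D.sidePoint s 0)) (0 : D.Dart → ℝ) s

theorem cornerHeight_rot {d : D.Dart} {s : D.Side} (h : D.sideDart s = D.inv d) :
    cornerHeight Ψ (D.rot d) = Ψ.height (D.sidePoint s 1) := by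
  have h1 : D.rot d = D.sideDart ⟨s.1, s.2 + 1⟩ := by
    change _ = D.bd s.1 (s.2 + 1)
    rw [D.bd_next]
    change _ = D.rot (D.inv (D.sideDart s))
    rw [h, D.inv_inv]
  exact (congrArg _ h1).trans
    ((cornerHeight_sideDart Ψ _).trans (congrArg Ψ.height (D.sidePoint_one s).symm))

/-- The corners of `d` and `rot d` are the ends of the two sides of the 1-cell over its source. The
order of the sides is the same over the closed 1-cell, so this end decides it. -/
theorem ascending_iff_cornerHeight_lt (himm : D.toTwoComplex.HasImmersedBoundaries) {d : D.Dart}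
    (h : D.IsInner d) (h' : D.IsInner (D.inv d)) :
    Ψ.Ascending d ↔ cornerHeight Ψ d < cornerHeight Ψ (D.rot d) := by
  have key : ∀ d, Ψ.Ascending d → cornerHeight Ψ d < cornerHeight Ψ (D.rot d) := by
    rintro _ ⟨s, s', rfl, hs', hlt⟩
    rw [cornerHeight_rot Ψ hs', cornerHeight_sideDart]
    simpa using hlt 0
  refine ⟨key d, fun hlt => by_contra fun hna => ?_⟩
  obtain ⟨s', s, hs', hs, hlt'⟩ := (ascending_inv Ψ himm h h').2 hna
  rw [D.inv_inv] at hs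
  subst hs
  rw [cornerHeight_rot Ψ hs', cornerHeight_sideDart] at hlt
  have := hlt' 1
  rw [unitInterval.symm_one] at this
  exact lt_asymm hlt this

theorem cornerHeight_ne (himm : D.toTwoComplex.HasImmersedBoundaries) {d : D.Dart}
    (h : D.IsInner d) (h' : D.IsInner (D.inv d)) :
    cornerHeight Ψ d ≠ cornerHeight Ψ (D.rot d) := by
  obtain ⟨s, rfl⟩ := h
  obtain ⟨s', hs'⟩ := h'
  rw [cornerHeight_rot Ψ hs', cornerHeight_sideDart]
  rcases Ψ.forall_lt_or_forall_lt himm hs' with h | h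
  · simpa using (h 0).ne
  · simpa using (h 0).ne'

/-- At an interior vertex, there is a lowest corner. -/
theorem exists_lowest_corner (himm : D.toTwoComplex.HasImmersedBoundaries) {x : D.Vertex}
    (hx : ∀ d, D.source d = x → D.IsInner d ∧ D.IsInner (D.inv d)) (hd : ∃ d, D.source d = x) :
    ∃ d, D.source d = x ∧ ¬ Ψ.Ascending d ∧ Ψ.Ascending (D.rot d) := by
  obtain ⟨m, hm, hmin⟩ := Set.exists_min_image {d | D.source d = x} (cornerHeight Ψ)
    (Set.toFinite _) hd
  -- The lowest corner is that of `rot d`: heights do not rise from `d` to `rot d`, and rise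
  -- strictly after it.
  obtain ⟨d, rfl⟩ := D.rot.surjective m
  have hs : D.source d = x := (D.source_rot d).symm.trans hm
  have hin := hx _ hs
  have hin' := hx _ hm
  refine ⟨d, hs, ?_, ?_⟩
  · rw [ascending_iff_cornerHeight_lt Ψ himm hin.1 hin.2, not_lt]
    exact hmin d hs
  · rw [ascending_iff_cornerHeight_lt Ψ himm hin'.1 hin'.2]
    exact lt_of_le_of_ne (hmin _ ((D.source_rot _).trans hm))
      (cornerHeight_ne Ψ himm hin'.1 hin'.2)

/-- At an interior vertex, there is a highest corner. -/
theorem exists_highest_corner (himm : D.toTwoComplex.HasImmersedBoundaries) {x : D.Vertex}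
    (hx : ∀ d, D.source d = x → D.IsInner d ∧ D.IsInner (D.inv d)) (hd : ∃ d, D.source d = x) :
    ∃ d, D.source d = x ∧ Ψ.Ascending d ∧ ¬ Ψ.Ascending (D.rot d) := by
  obtain ⟨m, hm, hmax⟩ := Set.exists_max_image {d | D.source d = x} (cornerHeight Ψ)
    (Set.toFinite _) hd
  obtain ⟨d, rfl⟩ := D.rot.surjective m
  have hs : D.source d = x := (D.source_rot d).symm.trans hm
  have hin := hx _ hs
  have hin' := hx _ hm
  refine ⟨d, hs, ?_, ?_⟩
  · rw [ascending_iff_cornerHeight_lt Ψ himm hin.1 hin.2]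
    exact lt_of_le_of_ne (hmax d hs) (cornerHeight_ne Ψ himm hin.1 hin.2)
  · rw [ascending_iff_cornerHeight_lt Ψ himm hin'.1 hin'.2, not_lt]
    exact hmax _ ((D.source_rot _).trans hm)

/-- In a good stacking, every 2-cell has a side along which it is not lower. -/
theorem exists_not_ascending (hΨ : Ψ.IsGood) {f : D.Cell} :
    ∃ i, ¬ Ψ.Ascending (D.bd f i) := by
  obtain ⟨h, hh, hmax⟩ := (hΨ f).1
  induction h using Quot.ind with
  | mk p =>
    obtain ⟨⟨f', i⟩, t⟩ := p
    obtain rfl : f' = f := hh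
    refine ⟨i, ?_⟩
    rintro ⟨s, s', hs, hs', hlt⟩
    obtain rfl : s = ⟨f', i⟩ := D.sideDart_injective hs
    exact (hlt t).not_ge (hmax _ (D.attach_sidePoint_symm hs' t))

/-- In a good stacking, an interior 2-cell has a side along which it is lower. -/
theorem exists_ascending (himm : D.toTwoComplex.HasImmersedBoundaries) (hΨ : Ψ.IsGood) {f : D.Cell}
    (hf : ∀ i, D.IsInner (D.inv (D.bd f i))) : ∃ i, Ψ.Ascending (D.bd f i) := by
  obtain ⟨l, hl, hmin⟩ := (hΨ f).2
  induction l using Quot.ind with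
  | mk p =>
    obtain ⟨⟨f', i⟩, t⟩ := p
    obtain rfl : f' = f := hl
    refine ⟨i, ?_⟩
    obtain ⟨s', hs'⟩ := hf i
    have hs' : D.sideDart s' = D.inv (D.sideDart ⟨f', i⟩) := hs'
    rcases Ψ.forall_lt_or_forall_lt himm hs' with h | h
    · exact ⟨_, s', rfl, hs', h⟩
    · exact absurd (hmin _ (D.attach_sidePoint_symm hs' t)) (h t).not_ge

/-- The sides of an edge of the dual graph are the two sides of an ascending dart. -/
theorem ascending_of_lower (himm : D.toTwoComplex.HasImmersedBoundaries) {s s' : D.Side}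
    (h : Ψ.Lower s s') :
    D.sideDart s' = D.inv (D.sideDart s) ∧ Ψ.Ascending (D.sideDart s) := by
  obtain ⟨hd, hlt⟩ := h
  -- `Lower` compares heights only over the open 1-cell; its midpoint suffices to decide the order,
  -- and also excludes a side being lower than itself.
  have hhalf : (⟨1 / 2, by norm_num, by norm_num⟩ : I) ∈ Set.Ioo (0 : I) 1 :=
    ⟨Subtype.mk_lt_mk.2 (by norm_num), Subtype.mk_lt_mk.2 (by norm_num)⟩
  have hhalf' : unitInterval.symm (⟨1 / 2, by norm_num, by norm_num⟩ : I) ∈ Set.Ioo (0 : I) 1 :=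
    ⟨Subtype.mk_lt_mk.2 (by norm_num), Subtype.mk_lt_mk.2 (by norm_num)⟩
  rcases hd with hd | hd
  · obtain rfl := D.sideDart_injective hd
    exact absurd (hlt _ hhalf _ hhalf rfl) (lt_irrefl _)
  · refine ⟨hd, s, s', rfl, hd, ?_⟩
    rcases Ψ.forall_lt_or_forall_lt himm hd with h | h
    · exact h
    · exact absurd (hlt _ hhalf _ hhalf' (D.attach_sidePoint_symm hd _).symm) (h _).not_gt

/-! ### From a directed cycle to a potential -/

/-- A directed path in the dual graph defines a flow along ascending darts from its first to its
last 2-cell. -/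
theorem exists_flow (himm : D.toTwoComplex.HasImmersedBoundaries) {a b : Ψ.DualGraph}
    (p : Quiver.Path a b) :
    ∃ φ : D.Dart → ℚ, (∀ d, φ (D.inv d) = - φ d) ∧ (∀ d, 0 < φ d → Ψ.Ascending d) ∧
      (∀ z : D.Cell → ℚ, ∑ d, φ d * D.faceFun z d = z a - z b) ∧
      (p.length ≠ 0 → ∃ d, φ d ≠ 0) := by
  classical
  induction p with
  | nil => exact ⟨0, by simp, by simp, by simp, by simp⟩
  | @cons b c p e ih =>
    obtain ⟨φ, h1, h2, h3, -⟩ := ih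
    obtain ⟨⟨i, j⟩, he⟩ := e
    obtain ⟨hinv, hasc⟩ := ascending_of_lower Ψ himm he
    set d₀ := D.sideDart ⟨b, i⟩
    have hswap : ∀ d, D.inv d = d₀ ↔ d = D.inv d₀ := fun d =>
      ⟨fun h => by rw [← h, D.inv_inv], fun h => by rw [h, D.inv_inv]⟩
    have hswap' : ∀ d, D.inv d = D.inv d₀ ↔ d = d₀ := fun d => D.inv_injective.eq_iff
    -- The last edge of the path adds one unit of flow across `d₀`, from `b` to `c`, so the pairing
    -- with `z` telescopes.
    refine ⟨fun d => φ d + ((if d = d₀ then 1 else 0) - (if d = D.inv d₀ then 1 else 0)),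
      fun d => ?_, fun d hd => ?_, fun z => ?_, fun _ => ⟨d₀, ?_⟩⟩
    · simp only [h1, hswap, hswap']
      ring
    · by_cases h : d = d₀
      · rwa [h]
      · refine h2 d (hd.trans_le ?_)
        simp only [if_neg h]
        split_ifs <;> linarith
    · have hb : D.faceFun z d₀ = z b := D.faceFun_sideDart z _
      have hc : D.faceFun z (D.inv d₀) = z c := by rw [← hinv]; exact D.faceFun_sideDart z _
      simp only [add_mul, sub_mul, ite_mul, one_mul, zero_mul, Finset.sum_add_distrib,
        Finset.sum_sub_distrib, h3, Finset.sum_ite_eq', Finset.mem_univ,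
        if_true, hb, hc]
      ring
    · have hin := isInner_of_ascending Ψ hasc
      -- There is no cancellation: a negative value at `d₀` would make `D.inv d₀` ascending as well.
      have h0 : 0 ≤ φ d₀ := by
        by_contra! hlt
        have := h2 (D.inv d₀) (by rw [h1]; linarith)
        exact (ascending_inv Ψ himm hin.1 hin.2).1 this hasc
      simp only [if_true, (D.inv_ne d₀).symm, if_false]
      linarith

end DiskDiagram

theorem mainTheorem3 (D : DiskDiagram.{u, v, w})
    (himm : D.toTwoComplex.HasImmersedBoundaries)
    (Ψ : D.toTwoComplex.Stacking) (hΨ : Ψ.IsGood) :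
    Quiver.IsAcyclicDigraph Ψ.DualGraph := by
  open DiskDiagram in
  intro a p
  by_contra hp
  obtain ⟨φ, h1, h2, h3, h4⟩ := exists_flow Ψ himm p
  obtain ⟨d₁, hd₁⟩ := h4 hp
  obtain ⟨o, ho⟩ := D.exists_not_isInner d₁
  obtain ⟨g, rfl⟩ := D.exists_eq_coboundary φ h1 (fun z => by rw [h3, sub_self])
  have hinv := fun d (h : D.IsInner d) h' => ascending_inv Ψ himm h h'
  have hpos : ∀ d, g (D.source d) < g (D.target d) → Ψ.Ascending d := fun d h =>
    h2 d (sub_pos.2 h)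
  have hneg : ∀ d, g (D.target d) < g (D.source d) → Ψ.Ascending (D.inv d) := fun d h =>
    h2 _ (by rw [h1]; exact neg_pos.2 (sub_neg.2 h))
  have hin : ∀ d, Ψ.Ascending (D.inv d) → D.IsInner d ∧ D.IsInner (D.inv d) := fun d h => by
    have := isInner_of_ascending Ψ h
    rw [D.inv_inv] at this
    exact this.symm
  have hout : ∀ d, ¬ D.IsInner d → g (D.target d) = g (D.source d) := by
    intro d hd
    rcases lt_trichotomy (g (D.target d)) (g (D.source d)) with h | h | h
    · exact absurd (hin d (hneg d h)).1 hd
    · exact h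
    · exact absurd (isInner_of_ascending Ψ (hpos d h)).1 hd
  -- `g` descends only along darts whose reverse is ascending, so `U` is the set of non-ascending
  -- darts here; for `-g` below it is the opposite orientation.
  have hle : ∀ y, g y ≤ g (D.source o) := by
    refine D.le_source_of_orientation (fun d => ¬ Ψ.Ascending d) g
      (fun d h h' => not_congr (hinv d h h')) (fun d h => ?_) hout (fun x hx hd => ?_)
      (fun f hf => ?_) o ho
    · have h' := hneg d h
      exact (hinv d (hin d h').1 (hin d h').2).1 h'
    · simpa only [not_not] using exists_highest_corner Ψ himm hx hd
    · refine ZMod.exists_and_not_add_one _ (exists_not_ascending Ψ hΨ) ?_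
      simpa only [not_not] using exists_ascending Ψ himm hΨ hf
  have hge : ∀ y, - g y ≤ - g (D.source o) := by
    refine D.le_source_of_orientation Ψ.Ascending (fun y => - g y) hinv
      (fun d h => hpos d (neg_lt_neg_iff.1 h)) (fun d h => congrArg _ (hout d h))
      (fun x hx hd => exists_lowest_corner Ψ himm hx hd) (fun f hf => ?_) o ho
    exact ZMod.exists_and_not_add_one _ (exists_ascending Ψ himm hΨ hf)
      (exists_not_ascending Ψ hΨ)
  have hc : ∀ y, g y = g (D.source o) := fun y => le_antisymm (hle y) (neg_le_neg_iff.1 (hge y))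
  refine hd₁ ?_
  rw [D.coboundary_apply, hc, hc (D.source d₁), sub_self]
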